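/- All graphs are finite and simple. A graph $\Gamma$ is strongly regular with parameters $(n,k,\lambda,\mu)$ if it has $n$ vertices, is $k$-regular, any two adjacent vertices have exactly $\lambda$ common neighbours, and any two distinct nonadjacent vertices have exactly $\mu$ common neighbours; $\Gamma$ is strongly regular if this holds for some parameters. It is self-complementary if it is isomorphic to its complement $\bar\Gamma$. The complementary prism $\Gamma\bar\Gamma$ is the graph obtained from the disjoint union of $\Gamma$ and $\bar\Gamma$ by adding, for each vertex $v$ of $\Gamma$, an edge joining the copy of $v$ in $\Gamma$ to the copy of $v$ in $\bar\Gamma$. A graph is a core if each of its endomorphisms (maps from the vertex set to itself that send adjacent vertices to adjacent vertices) is an automorphism. Theorem. If $\Gamma$ is a strongly regular self-complementary graph, then the complementary prism $\Gamma\bar\Gamma$ is a core. -/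

import Mathlib

namespace SimpleGraph

/-- A graph is self-complementary if it is isomorphic to its complement. -/
def IsSelfComplementary {V : Type*} (G : SimpleGraph V) : Prop :=
  Nonempty (G ≃g Gᶜ)

/-- The complementary prism of `G`: the disjoint union of `G` (the vertices `Sum.inl v`) and its
complement (the vertices `Sum.inr v`), together with the perfect matching that joins the two
copies of each vertex. -/
def complementaryPrism {V : Type*} (G : SimpleGraph V) : SimpleGraph (V ⊕ V) where
  Adj
    | Sum.inl u, Sum.inl v => G.Adj u v
    | Sum.inr u, Sum.inr v => Gᶜ.Adj u v
    | Sum.inl u, Sum.inr v => u = v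
    | Sum.inr u, Sum.inl v => u = v
  symm.symm
    | Sum.inl _, Sum.inl _ => G.adj_symm
    | Sum.inr _, Sum.inr _ => Gᶜ.adj_symm
    | Sum.inl _, Sum.inr _ => Eq.symm
    | Sum.inr _, Sum.inl _ => Eq.symm
  loopless.irrefl
    | Sum.inl u => G.loopless.irrefl u
    | Sum.inr u => Gᶜ.loopless.irrefl u

/-- A graph is a core if each of its endomorphisms is an automorphism. -/
def IsCore {V : Type*} (G : SimpleGraph V) : Prop :=
  ∀ f : G →g G, ∃ e : G ≃g G, ∀ v, e v = f v

end SimpleGraph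

set_option linter.unusedSectionVars false

/-! ### Injective endomorphisms of finite graphs. -/

namespace SimpleGraph

open Matrix

variable {V : Type*} [Fintype V] {G : SimpleGraph V}

/-! Beyond the one-vertex case, self-complementarity forces conference parameters `(4l+5, 2l+2, l,
l+1)`. For `l = 0` the prism is the Petersen graph, which is triangle-free with nonadjacent vertices
joined by 3-walks, so endomorphisms are injective.

For `l > 0` every edge of `G` and of `Gᶜ` lies in a triangle, and no triangle of the prism uses a
matching edge. So an endomorphism sends each part into a part. If the two images lie in different
parts, the matching edges force one vertex map on both parts; it preserves edges of `G` and keeps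
nonadjacent vertices apart, so it is injective. If they lie in the same part, there are
homomorphisms `f : G → G` and `g : Gᶜ → G`, up to `σ`, with `f v` adjacent to `g v`;
`IsSRGWith.not_adj_homs` excludes this.

That exclusion rests on `IsSRGWith.injective_or_adj`, whose spectral input is
`IsSRGWith.sum_conferenceGram`, and on the clique bound `√n`. -/

/-- An injective endomorphism of a finite graph reflects adjacency. -/
theorem Hom.adj_iff_of_injective (f : G →g G) (hf : Function.Injective f) (u v : V) :
    G.Adj (f u) (f v) ↔ G.Adj u v := by
  refine ⟨fun h ↦ ?_, f.map_adj⟩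
  have hinj : Function.Injective f.mapDart := by
    intro d e hde
    rw [Dart.ext_iff] at hde ⊢
    have h1 := congrArg Prod.fst hde
    have h2 := congrArg Prod.snd hde
    exact Prod.ext (hf h1) (hf h2)
  have : Finite G.Dart :=
    Finite.of_injective (fun d : G.Dart ↦ d.toProd) fun a b h ↦ Dart.ext _ _ h
  obtain ⟨d, hd⟩ := Finite.surjective_of_injective hinj ⟨(f u, f v), h⟩
  have h0 := congrArg Dart.toProd hd
  have h1 : f d.fst = f u := congrArg Prod.fst h0
  have h2 : f d.snd = f v := congrArg Prod.snd h0
  rw [← hf h1, ← hf h2]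
  exact d.adj

/-- An injective endomorphism of a finite graph, as an automorphism. -/
noncomputable def Hom.isoOfInjective (f : G →g G) (hf : Function.Injective f) : G ≃g G where
  toEquiv := Equiv.ofBijective f (Finite.injective_iff_bijective.mp hf)
  map_rel_iff' := f.adj_iff_of_injective hf _ _

@[simp]
theorem Hom.isoOfInjective_apply (f : G →g G) (hf : Function.Injective f) (v : V) :
    f.isoOfInjective hf v = f v := rfl

/-! ### Spectral theory of conference graphs. -/

variable [DecidableEq V] [DecidableRel G.Adj] {l : ℕ}

/-- The parameters of a conference graph on `4 * l + 5` vertices are those of its complement. -/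
theorem IsSRGWith.compl_conference (h : G.IsSRGWith (4 * l + 5) (2 * l + 2) l (l + 1)) :
    Gᶜ.IsSRGWith (4 * l + 5) (2 * l + 2) l (l + 1) := by
  have := h.compl
  convert this using 1 <;> omega

theorem IsSRGWith.adjMatrix_mul_self (h : G.IsSRGWith (4 * l + 5) (2 * l + 2) l (l + 1)) :
    G.adjMatrix ℝ * G.adjMatrix ℝ =
      ((l : ℝ) + 1) • (1 : Matrix V V ℝ) - G.adjMatrix ℝ +
        ((l : ℝ) + 1) • (of fun _ _ ↦ 1 : Matrix V V ℝ) := by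
  rw [← pow_two, h.matrix_eq]
  simp only [← Nat.cast_smul_eq_nsmul ℝ]
  ext u v
  by_cases huv : u = v
  · subst huv
    simp
    ring
  · by_cases ha : G.Adj u v <;> simp [ha, huv]

theorem IsSRGWith.adjMatrix_mul_one (h : G.IsSRGWith (4 * l + 5) (2 * l + 2) l (l + 1)) :
    G.adjMatrix ℝ * (of fun _ _ ↦ 1 : Matrix V V ℝ) =
      (2 * (l : ℝ) + 2) • (of fun _ _ ↦ 1 : Matrix V V ℝ) := by
  ext u v
  simp [adjMatrix_mul_apply, h.regular.degree_eq]

theorem IsSRGWith.one_mul_adjMatrix (h : G.IsSRGWith (4 * l + 5) (2 * l + 2) l (l + 1)) :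
    (of fun _ _ ↦ 1 : Matrix V V ℝ) * G.adjMatrix ℝ =
      (2 * (l : ℝ) + 2) • (of fun _ _ ↦ 1 : Matrix V V ℝ) := by
  ext u v
  simp [mul_adjMatrix_apply, h.regular.degree_eq]

theorem IsSRGWith.one_mul_one (h : G.IsSRGWith (4 * l + 5) (2 * l + 2) l (l + 1)) :
    (of fun _ _ ↦ 1 : Matrix V V ℝ) * (of fun _ _ ↦ 1 : Matrix V V ℝ) =
      (4 * (l : ℝ) + 5) • (of fun _ _ ↦ 1 : Matrix V V ℝ) := by
  ext u v
  simp [Matrix.mul_apply, h.card]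

variable (G) in
/-- For a conference graph on `q ^ 2` vertices, a multiple of the orthogonal projection onto the
eigenspace of the least eigenvalue. -/
def conferenceGram (q : ℝ) : Matrix V V ℝ :=
  (q ^ 2 - q) • (1 : Matrix V V ℝ) + (q - 1) • (of fun _ _ ↦ 1 : Matrix V V ℝ)
    - (2 * q) • G.adjMatrix ℝ

theorem conferenceGram_self (q : ℝ) (u : V) : G.conferenceGram q u u = q ^ 2 - 1 := by
  simp [conferenceGram]

theorem conferenceGram_of_adj (q : ℝ) {u v : V} (h : G.Adj u v) :
    G.conferenceGram q u v = -(1 + q) := by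
  simp [conferenceGram, h, h.ne]
  ring

theorem conferenceGram_of_not_adj (q : ℝ) {u v : V} (hne : u ≠ v) (h : ¬ G.Adj u v) :
    G.conferenceGram q u v = q - 1 := by
  simp [conferenceGram, h, hne]

theorem transpose_conferenceGram (q : ℝ) : (G.conferenceGram q)ᵀ = G.conferenceGram q := by
  ext u v
  simp [conferenceGram, Matrix.one_apply, G.adj_comm, eq_comm]

/-- The adjacency eigenvalues are `(q²-1)/2` on constants and `(±q-1)/2`; the Gram matrix acts as
`2q²` on the eigenspace of `-(q+1)/2` and as `0` on the others. -/
theorem IsSRGWith.conferenceGram_mul_self (h : G.IsSRGWith (4 * l + 5) (2 * l + 2) l (l + 1))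
    {q : ℝ} (hq : q ^ 2 = 4 * l + 5) :
    G.conferenceGram q * G.conferenceGram q = (2 * q ^ 2) • G.conferenceGram q := by
  obtain hl : (l : ℝ) = (q ^ 2 - 5) / 4 := by linarith
  simp only [conferenceGram, sub_mul, mul_sub, add_mul, mul_add, smul_mul_assoc, mul_smul_comm,
    one_mul, mul_one, h.one_mul_one, h.one_mul_adjMatrix, h.adjMatrix_mul_one,
    h.adjMatrix_mul_self, hl]
  module

/-- For an endomorphism of a conference graph, the pulled back Gram matrix has its columns in the
eigenspace of the least eigenvalue. -/
theorem IsSRGWith.sum_conferenceGram (h : G.IsSRGWith (4 * l + 5) (2 * l + 2) l (l + 1))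
    {q : ℝ} (hq0 : 0 < q) (hq : q ^ 2 = 4 * l + 5) (f : G →g G) (u w : V) :
    (1 + q) * G.conferenceGram q (f u) (f w) +
      2 * ∑ v ∈ G.neighborFinset u, G.conferenceGram q (f v) (f w) = 0 := by
  have hl : (l : ℝ) = (q ^ 2 - 5) / 4 := by linarith
  set P := G.conferenceGram q with hP
  set A := G.adjMatrix ℝ with hA
  set J : Matrix V V ℝ := of fun _ _ ↦ 1 with hJ
  -- `R` is positive semidefinite, with the least eigenspace as kernel. `T` is `2q²` times the
  -- projection onto the eigenspace of `(q-1)/2`, so `hRT` writes `R` as a sum of squares.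
  set R : Matrix V V ℝ := (1 + q) • (1 : Matrix V V ℝ) + (2 : ℝ) • A with hR
  set T : Matrix V V ℝ := q • R - (q + 1) • J with hT
  set B : Matrix V V ℝ := P.submatrix f id with hB
  have hBB : B * Bᵀ = (2 * q ^ 2) • P.submatrix f f := by
    have h1 : Bᵀ = P.submatrix id f := by
      rw [hB, transpose_submatrix, hP, transpose_conferenceGram]
    rw [h1, hB, ← submatrix_mul P P f id f Function.bijective_id, h.conferenceGram_mul_self hq]
    rfl
  have hTt : Tᵀ = T := by
    ext u v
    simp [hT, hR, hA, hJ, Matrix.one_apply, G.adj_comm, eq_comm]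
  have hJt : Jᵀ = J := by ext; simp [hJ]
  have hRT : (2 * q ^ 3) • R = Tᵀ * T + (2 * (q + 1)) • (Jᵀ * J) := by
    rw [hTt, hJt]
    simp only [hT, hR, sub_mul, mul_sub, add_mul, mul_add, smul_mul_assoc, mul_smul_comm,
      one_mul, mul_one, hA, hJ, h.one_mul_one, h.one_mul_adjMatrix, h.adjMatrix_mul_one,
      h.adjMatrix_mul_self, hl]
    module
  -- The diagonal of this product involves `P` only at equal or adjacent pairs, whose values `f`
  -- preserves. A product of positive semidefinite matrices with trace zero vanishes.
  have htr : (R * P.submatrix f f).trace = 0 := by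
    have h1 : ∀ u, (R * P.submatrix f f) u u = 0 := by
      intro u
      have : ∑ v ∈ G.neighborFinset u, P (f v) (f u) = (2 * (l : ℝ) + 2) * (-(1 + q)) := by
        rw [Finset.sum_congr rfl fun v hv ↦ conferenceGram_of_adj q
          (f.map_adj ((G.mem_neighborFinset u v).mp hv)).symm]
        rw [Finset.sum_const, card_neighborFinset_eq_degree, h.regular.degree_eq, nsmul_eq_mul]
        push_cast
        ring
      have hself : P (f u) (f u) = q ^ 2 - 1 := conferenceGram_self q _
      simp only [hR, add_mul, smul_mul_assoc, one_mul, hA, Matrix.add_apply, Matrix.smul_apply,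
        adjMatrix_mul_apply, submatrix_apply, this, smul_eq_mul, hself, hl]
      ring
    simp [Matrix.trace, h1]
  have hsum : ((T * B)ᵀ * (T * B)).trace + 2 * (q + 1) * ((J * B)ᵀ * (J * B)).trace = 0 := by
    have h0 : ∀ M : Matrix V V ℝ, ((M * B)ᵀ * (M * B)).trace = (Mᵀ * M * (B * Bᵀ)).trace := by
      intro M
      rw [transpose_mul, mul_assoc, trace_mul_comm]
      simp only [mul_assoc]
    have h1 : ((T * B)ᵀ * (T * B)).trace + 2 * (q + 1) * ((J * B)ᵀ * (J * B)).trace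
        = (2 * q ^ 3) * (2 * q ^ 2) * (R * P.submatrix f f).trace := by
      rw [mul_assoc (2 * q ^ 3), ← smul_eq_mul (2 * q ^ 2), ← trace_smul, ← mul_smul_comm, ← hBB,
        ← smul_eq_mul (2 * q ^ 3), ← trace_smul, ← smul_mul_assoc, hRT, h0, h0, add_mul,
        trace_add, smul_mul_assoc, trace_smul, smul_eq_mul]
    rw [h1, htr, mul_zero]
  have hnn : ∀ M : Matrix V V ℝ, 0 ≤ (Mᵀ * M).trace := fun M ↦ by
    simp only [Matrix.trace, diag_apply, Matrix.mul_apply, transpose_apply]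
    exact Finset.sum_nonneg fun i _ ↦ Finset.sum_nonneg fun j _ ↦ mul_self_nonneg _
  have hz : ∀ M : Matrix V V ℝ, (Mᵀ * M).trace = 0 → M = 0 := fun M hM ↦ by
    rw [← conjTranspose_eq_transpose_of_trivial] at hM
    exact trace_conjTranspose_mul_self_eq_zero_iff.mp hM
  have hTB : T * B = 0 := hz _ (by nlinarith [hnn (T * B), hnn (J * B)])
  have hJB : J * B = 0 := hz _ (by nlinarith [hnn (T * B), hnn (J * B)])
  have hRB : R * B = 0 := by
    have : q • (R * B) = T * B + (q + 1) • (J * B) := by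
      rw [hT, sub_mul, smul_mul_assoc, smul_mul_assoc, sub_add_cancel]
    rw [hTB, hJB, smul_zero, add_zero] at this
    exact (smul_eq_zero.mp this).resolve_left hq0.ne'
  have hRP : R * P.submatrix f f = 0 := by
    have : (2 * q ^ 2) • (R * P.submatrix f f) = 0 := by
      rw [← mul_smul_comm, ← hBB, ← mul_assoc, hRB, zero_mul]
    exact (smul_eq_zero.mp this).resolve_left (by positivity)
  have := congrFun (congrFun hRP u) w
  simpa [hR, add_mul, hA, adjMatrix_mul_apply] using this

/-- The clique bound for conference graphs. -/
theorem IsSRGWith.card_le_of_isClique (h : G.IsSRGWith (4 * l + 5) (2 * l + 2) l (l + 1))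
    {q : ℝ} (hq0 : 0 < q) (hq : q ^ 2 = 4 * l + 5) {s : Finset V} (hs : G.IsClique s) :
    (s.card : ℝ) ≤ q := by
  rcases s.eq_empty_or_nonempty with rfl | hne
  · simpa using hq0.le
  have hpos : (0 : ℝ) < s.card := by exact_mod_cast hne.card_pos
  -- Evaluate the positive semidefinite form at the indicator vector of `s`.
  have h1 : ∑ x ∈ s, ∑ y ∈ s, G.conferenceGram q x y =
      s.card * ((q ^ 2 - 1) - (s.card - 1) * (1 + q)) := by
    have : ∀ x ∈ s, ∑ y ∈ s, G.conferenceGram q x y =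
        (q ^ 2 - 1) - (s.card - 1) * (1 + q) := by
      intro x hx
      rw [← Finset.add_sum_erase _ _ hx, conferenceGram_self,
        Finset.sum_congr rfl fun y hy ↦ conferenceGram_of_adj q
          (hs hx (Finset.mem_of_mem_erase hy) (Finset.ne_of_mem_erase hy).symm)]
      rw [Finset.sum_const, Finset.card_erase_of_mem hx, nsmul_eq_mul,
        Nat.cast_sub hne.card_pos]
      push_cast
      ring
    rw [Finset.sum_congr rfl this, Finset.sum_const, nsmul_eq_mul]
  have h2 : 2 * q ^ 2 * ∑ x ∈ s, ∑ y ∈ s, G.conferenceGram q x y =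
      ∑ z, (∑ x ∈ s, G.conferenceGram q z x) ^ 2 := by
    have : ∀ x y, 2 * q ^ 2 * G.conferenceGram q x y =
        ∑ z, G.conferenceGram q z x * G.conferenceGram q z y := by
      intro x y
      have := congrFun (congrFun (h.conferenceGram_mul_self hq) x) y
      rw [Matrix.smul_apply, smul_eq_mul] at this
      rw [← this, Matrix.mul_apply]
      refine Finset.sum_congr rfl fun z _ ↦ congrArg (· * _) ?_
      exact congrFun (congrFun (transpose_conferenceGram (G := G) q) z) x
    simp only [Finset.mul_sum, this, pow_two (Finset.sum _ _), Finset.sum_mul]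
    exact Finset.sum_comm.trans
      ((Finset.sum_congr rfl fun x _ ↦ Finset.sum_comm).trans Finset.sum_comm)
  have h3 : 0 ≤ (s.card : ℝ) * ((q ^ 2 - 1) - (s.card - 1) * (1 + q)) := by
    rw [← h1]
    have : 0 ≤ 2 * q ^ 2 * ∑ x ∈ s, ∑ y ∈ s, G.conferenceGram q x y := by
      rw [h2]; positivity
    exact nonneg_of_mul_nonneg_right this (by positivity)
  have h4 := nonneg_of_mul_nonneg_right h3 hpos
  nlinarith

end SimpleGraph

/-! ### Endomorphisms of conference graphs. -/

namespace SimpleGraph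

variable {V : Type*} [Fintype V] [DecidableEq V] {G : SimpleGraph V} [DecidableRel G.Adj] {l : ℕ}

theorem IsSRGWith.card_inter_of_not_adj {n k m : ℕ} (h : G.IsSRGWith n k l m) {u v : V}
    (hne : u ≠ v) (ha : ¬ G.Adj u v) :
    (G.neighborFinset u ∩ G.neighborFinset v).card = m := by
  rw [← h.of_not_adj hne ha, ← Set.toFinset_card]
  congr 1
  ext x
  rw [Finset.mem_inter, Set.mem_toFinset, mem_neighborFinset, mem_neighborFinset]
  rfl

theorem IsSRGWith.card_inter_of_adj {n k m : ℕ} (h : G.IsSRGWith n k l m) {u v : V}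
    (ha : G.Adj u v) : (G.neighborFinset u ∩ G.neighborFinset v).card = l := by
  rw [← h.of_adj u v ha, ← Set.toFinset_card]
  congr 1
  ext x
  rw [Finset.mem_inter, Set.mem_toFinset, mem_neighborFinset, mem_neighborFinset]
  rfl

theorem IsSRGWith.exists_common_of_not_adj {n k m : ℕ} (h : G.IsSRGWith n k l (m + 1)) {u v : V}
    (hne : u ≠ v) (ha : ¬ G.Adj u v) : ∃ w, G.Adj u w ∧ G.Adj v w := by
  have h1 : (G.neighborFinset u ∩ G.neighborFinset v).Nonempty := by
    rw [← Finset.card_pos, h.card_inter_of_not_adj hne ha]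
    omega
  obtain ⟨w, hw⟩ := h1
  exact ⟨w, by simpa using hw⟩

theorem IsSRGWith.exists_common_of_adj {n k m : ℕ} (h : G.IsSRGWith n k l m) (hl : l ≠ 0)
    {u v : V} (ha : G.Adj u v) : ∃ w, G.Adj u w ∧ G.Adj v w := by
  have h1 : (G.neighborFinset u ∩ G.neighborFinset v).Nonempty := by
    rw [← Finset.card_pos, h.card_inter_of_adj ha]
    omega
  obtain ⟨w, hw⟩ := h1
  exact ⟨w, by simpa using hw⟩

/-- If an endomorphism of a conference graph keeps `u` and `w` distinct and nonadjacent, then it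
does so for `v` and `w`, where `v` is any neighbour of `u` that is not a neighbour of `w`. -/
theorem IsSRGWith.not_adj_map_step (h : G.IsSRGWith (4 * l + 5) (2 * l + 2) l (l + 1))
    (f : G →g G) {u v w : V} (hg : Gᶜ.Adj (f u) (f w)) (huv : G.Adj u v) (hvw : ¬ G.Adj v w) :
    Gᶜ.Adj (f v) (f w) := by
  rw [compl_adj] at hg
  obtain ⟨hne, hna⟩ := hg
  set q : ℝ := √(4 * l + 5) with hqdef
  have hq0 : 0 < q := Real.sqrt_pos.mpr (by positivity)
  have hq : q ^ 2 = 4 * l + 5 := Real.sq_sqrt (by positivity)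
  have key := h.sum_conferenceGram hq0 hq f u w
  rw [conferenceGram_of_not_adj q hne hna] at key
  have hne' : ∀ x, G.Adj u x → f x ≠ f w := fun x hx hxw ↦ hna (hxw ▸ f.map_adj hx)
  set S := (G.neighborFinset u).filter (fun x ↦ G.Adj (f x) (f w)) with hS
  have hsum : ∑ x ∈ G.neighborFinset u, G.conferenceGram q (f x) (f w) =
      (2 * l + 2) * (q - 1) - 2 * q * S.card := by
    have h1 : ∀ x ∈ G.neighborFinset u, G.conferenceGram q (f x) (f w) =
        (q - 1) - 2 * q * (if G.Adj (f x) (f w) then 1 else 0) := by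
      intro x hx
      rw [mem_neighborFinset] at hx
      split_ifs with hadj
      · rw [conferenceGram_of_adj q hadj]; ring
      · rw [conferenceGram_of_not_adj q (hne' x hx) hadj]; ring
    rw [Finset.sum_congr rfl h1, Finset.sum_sub_distrib, ← Finset.mul_sum, Finset.sum_boole,
      Finset.sum_const, card_neighborFinset_eq_degree, h.regular.degree_eq, nsmul_eq_mul]
    push_cast
    ring
  rw [hsum] at key
  -- The spectral identity fixes the size of `S` as the number of common neighbours of `u` and `w`.
  -- These all lie in `S`, so they exhaust it.
  have hcard : (S.card : ℝ) = l + 1 := by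
    have : 4 * q * ((S.card : ℝ) - (l + 1)) = 0 := by linear_combination hq - key
    have := (mul_eq_zero.mp this).resolve_left (by positivity)
    linarith
  have hcard' : S.card = l + 1 := by exact_mod_cast hcard
  have hsub : G.neighborFinset u ∩ G.neighborFinset w ⊆ S := by
    intro x hx
    simp only [Finset.mem_inter, mem_neighborFinset] at hx
    simp only [hS, Finset.mem_filter, mem_neighborFinset]
    exact ⟨hx.1, f.map_adj hx.2.symm⟩
  have heq := Finset.eq_of_subset_of_card_le hsub (by
    rw [hcard', h.card_inter_of_not_adj (fun e ↦ hne (congrArg f e)) (fun a ↦ hna (f.map_adj a))])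
  refine (compl_adj _ _ _).mpr ⟨hne' v huv, fun hadj ↦ hvw ?_⟩
  have : v ∈ S := by simp [hS, huv, hadj]
  rw [← heq] at this
  simpa [G.adj_comm] using (Finset.mem_inter.mp this).2

/-- The set of nonneighbours of a vertex of a conference graph is connected, in the form that a
property which propagates along its edges holds for all its vertices or none. -/
theorem IsSRGWith.induction_nonneighbors (h : G.IsSRGWith (4 * l + 5) (2 * l + 2) l (l + 1))
    {w : V} {p : V → Prop} (hp : ∀ u v, Gᶜ.Adj w u → Gᶜ.Adj w v → G.Adj u v → p u → p v)
    {u v : V} (hu : Gᶜ.Adj w u) (hv : Gᶜ.Adj w v) (hpu : p u) : p v := by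
  let N : V → Finset V := fun x ↦ insert x (G.neighborFinset x \ G.neighborFinset w)
  have hNcard : ∀ x, Gᶜ.Adj w x → (N x).card = l + 2 := by
    intro x hx
    rw [compl_adj] at hx
    have h1 := Finset.card_sdiff_add_card_inter (G.neighborFinset x) (G.neighborFinset w)
    rw [h.card_inter_of_not_adj (Ne.symm hx.1) (fun a ↦ hx.2 a.symm),
      card_neighborFinset_eq_degree, h.regular.degree_eq] at h1
    rw [Finset.card_insert_of_notMem (by simp)]
    omega
  have hNsub : ∀ x, Gᶜ.Adj w x → N x ⊆ Gᶜ.neighborFinset w := by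
    intro x hx y hy
    rw [mem_neighborFinset]
    simp only [N, Finset.mem_insert, Finset.mem_sdiff, mem_neighborFinset] at hy
    rcases hy with rfl | ⟨hxy, hwy⟩
    · exact hx
    · refine (compl_adj _ _ _).mpr ⟨?_, hwy⟩
      rintro rfl
      exact ((compl_adj _ _ _).mp hx).2 hxy.symm
  -- Two closed neighbourhoods of size `l + 2` must meet among the `2l + 2` nonneighbours of `w`.
  have hint : ((N u) ∩ (N v)).Nonempty := by
    rw [← Finset.card_pos]
    have h1 := Finset.card_union_add_card_inter (N u) (N v)
    have h2 := Finset.card_le_card (Finset.union_subset (hNsub u hu) (hNsub v hv))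
    rw [card_neighborFinset_eq_degree, h.compl_conference.regular.degree_eq] at h2
    rw [hNcard u hu, hNcard v hv] at h1
    omega
  obtain ⟨x, hx⟩ := hint
  rw [Finset.mem_inter] at hx
  have hwx : Gᶜ.Adj w x := by simpa using hNsub u hu hx.1
  have hpx : p x := by
    rcases Finset.mem_insert.mp hx.1 with rfl | h1
    · exact hpu
    · exact hp u x hu hwx (by simpa using (Finset.mem_sdiff.mp h1).1) hpu
  rcases Finset.mem_insert.mp hx.2 with rfl | h1
  · exact hpx
  · exact hp x v hwx hv (by simpa [G.adj_comm] using (Finset.mem_sdiff.mp h1).1) hpx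

/-- An endomorphism of a conference graph is injective or has a clique as its image. -/
theorem IsSRGWith.injective_or_adj (h : G.IsSRGWith (4 * l + 5) (2 * l + 2) l (l + 1))
    (f : G →g G) : Function.Injective f ∨ ∀ u v, f u ≠ f v → G.Adj (f u) (f v) := by
  by_cases hex : ∀ u v, f u ≠ f v → G.Adj (f u) (f v)
  · exact Or.inr hex
  refine Or.inl ?_
  push Not at hex
  obtain ⟨u, w, hne, hna⟩ := hex
  have of_map : ∀ {x y}, Gᶜ.Adj (f x) (f y) → Gᶜ.Adj x y := fun hxy ↦ by
    rw [compl_adj] at hxy ⊢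
    exact ⟨fun e ↦ hxy.1 (congrArg f e), fun a ↦ hxy.2 (f.map_adj a)⟩
  have all_of_one : ∀ w, (∃ u, Gᶜ.Adj (f u) (f w)) → ∀ v, Gᶜ.Adj w v → Gᶜ.Adj (f v) (f w) := by
    rintro w ⟨u, hu⟩ v hv
    refine h.induction_nonneighbors (w := w) (p := fun x ↦ Gᶜ.Adj (f x) (f w))
      (fun x y hx hy hxy hpx ↦ ?_) (of_map hu).symm hv hu
    exact h.not_adj_map_step f hpx hxy fun a ↦ ((compl_adj _ _ _).mp hy).2 a.symm
  have hw : ∃ u, Gᶜ.Adj (f u) (f w) := ⟨u, (compl_adj _ _ _).mpr ⟨hne, hna⟩⟩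
  have hall : ∀ x, ∃ y, Gᶜ.Adj (f y) (f x) := by
    intro x
    by_cases hxw : x = w
    · exact hxw ▸ hw
    by_cases ha : Gᶜ.Adj w x
    · exact ⟨w, (all_of_one w hw x ha).symm⟩
    -- Adjacent vertices `w` and `x` have a common nonneighbour, through which the property passes.
    · obtain ⟨y, hwy, hxy⟩ := h.compl_conference.exists_common_of_not_adj (Ne.symm hxw) ha
      exact ⟨y, (all_of_one y ⟨w, (all_of_one w hw y hwy).symm⟩ x hxy.symm).symm⟩
  intro x y hxy
  by_contra hne
  by_cases ha : G.Adj x y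
  · exact (f.map_adj ha).ne hxy
  · exact (all_of_one y (hall y) x ((compl_adj _ _ _).mpr ⟨Ne.symm hne, fun a ↦ ha a.symm⟩)).ne hxy

/-- In a conference graph there is no homomorphism from the complement that has a clique as its
image and sends each vertex to a neighbour. -/
theorem IsSRGWith.not_adj_hom_compl (h : G.IsSRGWith (4 * l + 5) (2 * l + 2) l (l + 1))
    (g : Gᶜ →g G) (hg : ∀ u v, g u ≠ g v → G.Adj (g u) (g v)) (hadj : ∀ v, G.Adj v (g v)) :
    False := by
  set q : ℝ := √(4 * l + 5) with hqdef
  have hq0 : 0 < q := Real.sqrt_pos.mpr (by positivity)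
  have hq : q ^ 2 = 4 * l + 5 := Real.sq_sqrt (by positivity)
  have hC : ((Finset.univ.image g).card : ℝ) ≤ q := by
    refine h.card_le_of_isClique hq0 hq ?_
    intro a ha b hb hab
    simp only [Finset.coe_image, Finset.coe_univ, Set.image_univ, Set.mem_range] at ha hb
    obtain ⟨x, rfl⟩ := ha
    obtain ⟨y, rfl⟩ := hb
    exact hg x y hab
  -- A fibre of `g` is a clique of `G`, and `c` is adjacent to all of it, which saves one. Then `q²
  -- = n ≤ q(q - 1)`, a contradiction.
  have hF : ∀ c : V, ((Finset.univ.filter (g · = c)).card : ℝ) ≤ q - 1 := by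
    intro c
    have hcl : G.IsClique (insert c (Finset.univ.filter (g · = c)) : Finset V) := by
      rw [Finset.coe_insert, isClique_insert]
      refine ⟨?_, ?_⟩
      · intro a ha b hb hab
        simp only [Finset.coe_filter, Finset.mem_univ, true_and, Set.mem_ofPred_eq] at ha hb
        by_contra hn
        exact (g.map_adj ((compl_adj _ _ _).mpr ⟨hab, hn⟩)).ne (ha.trans hb.symm)
      · intro b hb _
        simp only [Finset.coe_filter, Finset.mem_univ, true_and, Set.mem_ofPred_eq] at hb
        exact hb ▸ (hadj b).symm
    have h1 := h.card_le_of_isClique hq0 hq hcl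
    rw [Finset.card_insert_of_notMem] at h1
    · push_cast at h1
      linarith
    · simp only [Finset.mem_filter, Finset.mem_univ, true_and]
      intro hc
      exact (hadj c).ne hc.symm
  have hn : (4 * l + 5 : ℝ) =
      ∑ c ∈ Finset.univ.image g, ((Finset.univ.filter (g · = c)).card : ℝ) := by
    have := Finset.card_eq_sum_card_image g Finset.univ
    rw [Finset.card_univ, h.card] at this
    exact_mod_cast this
  have h2 := Finset.sum_le_sum fun c (_ : c ∈ Finset.univ.image g) ↦ hF c
  rw [← hn, Finset.sum_const, nsmul_eq_mul, ← hq] at h2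
  have hl : (0 : ℝ) ≤ l := by positivity
  have hq1 : 1 < q := by nlinarith
  nlinarith

/-- In a self-complementary conference graph no homomorphisms from the graph and its complement to
the graph have adjacent values everywhere. -/
theorem IsSRGWith.not_adj_homs (h : G.IsSRGWith (4 * l + 5) (2 * l + 2) l (l + 1))
    (σ : G ≃g Gᶜ) (f : G →g G) (g : Gᶜ →g G) (hadj : ∀ v, G.Adj (f v) (g v)) : False := by
  have hgσ := h.injective_or_adj (g.comp σ.toHom)
  have hiff : Function.Injective (g.comp σ.toHom) → ∀ u v, G.Adj (g u) (g v) ↔ Gᶜ.Adj u v := by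
    intro hg u v
    have := (g.comp σ.toHom).adj_iff_of_injective hg (σ.symm u) (σ.symm v)
    rw [σ.symm.map_adj_iff] at this
    simpa using this
  rcases h.injective_or_adj f with hf | hf
  -- Composing with the inverse of `f` reduces to `f = id`.
  · have hψ : ∀ v, G.Adj v ((f.isoOfInjective hf).symm (g v)) := fun v ↦ by
      rw [← (f.isoOfInjective hf).map_adj_iff]
      simpa using hadj v
    rcases hgσ with hg | hg
    · obtain ⟨v⟩ : Nonempty V := Fintype.card_pos_iff.mp (by rw [h.card]; omega)
      -- With `ψ = f⁻¹g`, the vertices `ψ v` and `ψ (ψ v)` are adjacent, yet `ψ` turns the edge from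
      -- `v` to `ψ v` into a non-edge.
      have h1 := hψ ((f.isoOfInjective hf).symm (g v))
      rw [(f.isoOfInjective hf).symm.map_adj_iff, hiff hg] at h1
      exact ((compl_adj _ _ _).mp h1).2 (hψ v)
    · refine h.not_adj_hom_compl ((f.isoOfInjective hf).symm.toHom.comp g) (fun u v huv ↦ ?_) hψ
      have := hg (σ.symm u) (σ.symm v)
      simp at this huv ⊢
      exact (f.isoOfInjective hf).symm.map_adj_iff.mpr (this huv)
  · rcases hgσ with hg | hg
    · have hginj : Function.Injective g := fun a b hab ↦ by
        have := @hg (σ.symm a) (σ.symm b) (by simpa using hab)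
        simpa using this
      let e : V ≃ V := Equiv.ofBijective g (Finite.injective_iff_bijective.mp hginj)
      have he : ∀ v, g (e.symm v) = v := e.apply_symm_apply
      let ψ : Gᶜ →g G :=
        ⟨fun v ↦ f (e.symm v), fun {a b} hab ↦ f.map_adj (by
          by_contra hn
          rw [compl_adj] at hab
          refine hab.2 ?_
          rw [← he a, ← he b, hiff hg, compl_adj]
          exact ⟨fun e' ↦ hab.1 (e.symm.injective e'), hn⟩)⟩
      refine h.not_adj_hom_compl ψ (fun u v huv ↦ hf _ _ huv) fun v ↦ ?_
      have := (hadj (e.symm v)).symm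
      rwa [he] at this
    · have hg' : ∀ u v, g u ≠ g v → G.Adj (g u) (g v) := fun u v huv ↦ by
        have := hg (σ.symm u) (σ.symm v)
        simp at this
        exact this huv
      set q : ℝ := √(4 * l + 5) with hqdef
      have hq0 : 0 < q := Real.sqrt_pos.mpr (by positivity)
      have hq : q ^ 2 = 4 * l + 5 := Real.sq_sqrt (by positivity)
      set C := Finset.univ.image f
      set D := Finset.univ.image g
      have hC : G.IsClique (C : Set V) := by
        intro a ha b hb hab
        simp only [C, Finset.coe_image, Finset.coe_univ, Set.image_univ, Set.mem_range] at ha hb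
        obtain ⟨x, rfl⟩ := ha
        obtain ⟨y, rfl⟩ := hb
        exact hf x y hab
      have hD : G.IsClique (D : Set V) := by
        intro a ha b hb hab
        simp only [D, Finset.coe_image, Finset.coe_univ, Set.image_univ, Set.mem_range] at ha hb
        obtain ⟨x, rfl⟩ := ha
        obtain ⟨y, rfl⟩ := hb
        exact hg' x y hab
      have hCq := h.card_le_of_isClique hq0 hq hC
      have hDq := h.card_le_of_isClique hq0 hq hD
      -- With both images cliques, `q² = n ≤ |C||D| ≤ q²`. Equality makes every vertex of `C`
      -- adjacent to every vertex of `D`, so `C ∪ D` is a clique of size at least `2q`.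
      let F : V → V × V := fun v ↦ (f v, g v)
      have hF : Function.Injective F := by
        intro a b hab
        have h1 : f a = f b := congrArg Prod.fst hab
        have h2 : g a = g b := congrArg Prod.snd hab
        by_contra hne
        by_cases ha : G.Adj a b
        · exact (f.map_adj ha).ne h1
        · exact (g.map_adj ((compl_adj _ _ _).mpr ⟨hne, ha⟩)).ne h2
      have hsub : Finset.univ.image F ⊆ C ×ˢ D := by
        intro x hx
        obtain ⟨v, -, rfl⟩ := Finset.mem_image.mp hx
        simp [F, C, D]
      have hFcard : (Finset.univ.image F).card = 4 * l + 5 := by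
        rw [Finset.card_image_of_injective _ hF, Finset.card_univ, h.card]
      have hn : (C.card * D.card : ℝ) ≤ 4 * l + 5 := by
        rw [← hq]; nlinarith [Nat.cast_nonneg (α := ℝ) C.card, Nat.cast_nonneg (α := ℝ) D.card]
      have heq := Finset.eq_of_subset_of_card_le hsub (by
        rw [hFcard, Finset.card_product]; exact_mod_cast hn)
      have hCD : ∀ c ∈ C, ∀ d ∈ D, G.Adj c d := by
        intro c hc d hd
        have : (c, d) ∈ Finset.univ.image F := heq ▸ Finset.mk_mem_product hc hd
        obtain ⟨v, -, hv⟩ := Finset.mem_image.mp this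
        obtain ⟨rfl, rfl⟩ := Prod.mk.inj hv
        exact hadj v
      have hdisj : Disjoint C D := Finset.disjoint_left.mpr fun x hx hx' ↦ (hCD x hx x hx').ne rfl
      have hU : G.IsClique ((C ∪ D : Finset V) : Set V) := by
        rw [Finset.coe_union]
        rintro a (ha | ha) b (hb | hb) hab
        · exact hC ha hb hab
        · exact hCD a ha b hb
        · exact (hCD b hb a ha).symm
        · exact hD ha hb hab
      have hUq := h.card_le_of_isClique hq0 hq hU
      rw [Finset.card_union_of_disjoint hdisj] at hUq
      have hprod : (C.card * D.card : ℝ) = q ^ 2 := by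
        rw [hq, ← Nat.cast_mul, ← Finset.card_product, ← heq, hFcard]
        push_cast; rfl
      push_cast at hUq
      nlinarith [sq_nonneg ((C.card : ℝ) - D.card)]

end SimpleGraph

/-! ### Endomorphisms of complementary prisms. -/

namespace SimpleGraph

theorem isCore_of_injective {W : Type*} [Finite W] {H : SimpleGraph W}
    (hinj : ∀ f : H →g H, Function.Injective f) : H.IsCore := by
  have := Fintype.ofFinite W
  exact fun f ↦ ⟨f.isoOfInjective (hinj f), fun _ ↦ rfl⟩

/-- An endomorphism of a triangle-free graph is injective if any two distinct nonadjacent vertices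
are joined by a walk of length three. -/
theorem Hom.injective_of_walk_three {W : Type*} {H : SimpleGraph W}
    (htri : ∀ a b c, H.Adj a b → H.Adj b c → ¬ H.Adj c a)
    (hwalk : ∀ a b, a ≠ b → ¬ H.Adj a b → ∃ x y, H.Adj a x ∧ H.Adj x y ∧ H.Adj y b)
    (f : H →g H) : Function.Injective f := by
  intro a b hab
  by_contra hne
  by_cases ha : H.Adj a b
  · exact (f.map_adj ha).ne hab
  · obtain ⟨x, y, h1, h2, h3⟩ := hwalk a b hne ha
    refine htri _ _ _ (f.map_adj h1) (f.map_adj h2) ?_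
    rw [hab]
    exact f.map_adj h3

section

variable {V : Type*} {G : SimpleGraph V}

@[simp]
theorem complementaryPrism_adj_inl_inl {u v : V} :
    G.complementaryPrism.Adj (.inl u) (.inl v) ↔ G.Adj u v := Iff.rfl

@[simp]
theorem complementaryPrism_adj_inr_inr {u v : V} :
    G.complementaryPrism.Adj (.inr u) (.inr v) ↔ Gᶜ.Adj u v := Iff.rfl

@[simp]
theorem complementaryPrism_adj_inl_inr {u v : V} :
    G.complementaryPrism.Adj (.inl u) (.inr v) ↔ u = v := Iff.rfl

@[simp]
theorem complementaryPrism_adj_inr_inl {u v : V} :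
    G.complementaryPrism.Adj (.inr u) (.inl v) ↔ u = v := Iff.rfl

/-- A triangle in a complementary prism lies in one of its two parts. -/
theorem isLeft_eq_of_triangle {a b c : V ⊕ V} (hab : G.complementaryPrism.Adj a b)
    (hbc : G.complementaryPrism.Adj b c) (hca : G.complementaryPrism.Adj c a) :
    a.isLeft = b.isLeft := by
  rcases a with a | a <;> rcases b with b | b <;> rcases c with c | c <;>
    simp only [complementaryPrism_adj_inl_inl, complementaryPrism_adj_inr_inr,
      complementaryPrism_adj_inl_inr, complementaryPrism_adj_inr_inl, Sum.isLeft_inl,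
      Sum.isLeft_inr] at *
  all_goals subst_vars
  all_goals simp_all

variable [Fintype V] [DecidableEq V] [DecidableRel G.Adj] {l : ℕ}

/-- A homomorphism from a conference graph whose edges lie in triangles to a complementary prism
has its image in one of the two parts. -/
theorem IsSRGWith.isLeft_hom_eq (h : G.IsSRGWith (4 * l + 5) (2 * l + 2) l (l + 1)) (hl : l ≠ 0)
    {W : Type*} {H : SimpleGraph W} (f : G →g H.complementaryPrism) (u v : V) :
    (f u).isLeft = (f v).isLeft := by
  have hadj : ∀ {u v}, G.Adj u v → (f u).isLeft = (f v).isLeft := fun {u v} huv ↦ by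
    obtain ⟨w, hu, hv⟩ := h.exists_common_of_adj hl huv
    exact isLeft_eq_of_triangle (f.map_adj huv) (f.map_adj hv) (f.map_adj hu.symm)
  by_cases hne : u = v
  · rw [hne]
  by_cases ha : G.Adj u v
  · exact hadj ha
  · obtain ⟨w, hu, hv⟩ := h.exists_common_of_not_adj hne ha
    exact (hadj hu).trans (hadj hv).symm

theorem IsSRGWith.isCore_complementaryPrism_of_ne_zero
    (h : G.IsSRGWith (4 * l + 5) (2 * l + 2) l (l + 1)) (hl : l ≠ 0) (σ : G ≃g Gᶜ) :
    G.complementaryPrism.IsCore := by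
  refine isCore_of_injective fun f ↦ ?_
  let i : G →g G.complementaryPrism := ⟨.inl, id⟩
  let j : Gᶜ →g G.complementaryPrism := ⟨.inr, id⟩
  have hi := h.isLeft_hom_eq hl (f.comp i)
  have hj := h.compl_conference.isLeft_hom_eq hl (f.comp j)
  have hm : ∀ v, G.complementaryPrism.Adj (f (.inl v)) (f (.inr v)) := fun v ↦ f.map_adj rfl
  obtain ⟨o⟩ : Nonempty V := Fintype.card_pos_iff.mp (by rw [h.card]; omega)
  have hil : ∀ v, (f (.inl v)).isLeft = (f (.inl o)).isLeft := fun v ↦ hi v o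
  have hjl : ∀ v, (f (.inr v)).isLeft = (f (.inr o)).isLeft := fun v ↦ hj v o
  have hG : ∀ {u v}, G.Adj u v → G.complementaryPrism.Adj (f (.inl u)) (f (.inl v)) :=
    fun huv ↦ (f.comp i).map_adj huv
  have hGc : ∀ {u v}, Gᶜ.Adj u v → G.complementaryPrism.Adj (f (.inr u)) (f (.inr v)) :=
    fun huv ↦ (f.comp j).map_adj huv
  have hinj : ∀ {a : V → V} {H K : SimpleGraph V}, (∀ {u v}, G.Adj u v → H.Adj (a u) (a v)) →
      (∀ {u v}, Gᶜ.Adj u v → K.Adj (a u) (a v)) → Function.Injective a := by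
    intro a H K hH hK u v huv
    by_contra hne
    by_cases hadj : G.Adj u v
    · exact (hH hadj).ne huv
    · exact (hK ((compl_adj _ _ _).mpr ⟨hne, hadj⟩)).ne huv
  -- The mixed cases give injectivity; the other two are impossible, and `σ.symm` carries the one
  -- landing in the complement back to `G`.
  cases ho : (f (.inl o)).isLeft <;> cases ho' : (f (.inr o)).isLeft <;>
    simp only [ho, ho', Sum.isLeft_iff, Sum.isLeft_eq_false, Sum.isRight_iff] at hil hjl <;>
    choose a ha using hil <;> choose b hb using hjl <;>
    simp only [ha, hb, complementaryPrism_adj_inl_inl, complementaryPrism_adj_inr_inr,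
      complementaryPrism_adj_inl_inr, complementaryPrism_adj_inr_inl] at hm hG hGc
  · exact (h.not_adj_homs σ (σ.symm.toHom.comp ⟨a, @hG⟩) (σ.symm.toHom.comp ⟨b, @hGc⟩)
      fun v ↦ σ.symm.map_adj_iff.mpr (hm v)).elim
  · obtain rfl : a = b := funext hm
    exact fun
      | .inl u, .inl v, huv => congrArg _ (hinj hG hGc (Sum.inr_injective (by rwa [ha, ha] at huv)))
      | .inr u, .inr v, huv => congrArg _ (hinj hG hGc (Sum.inl_injective (by rwa [hb, hb] at huv)))
      | .inl u, .inr v, huv => by simp [ha, hb] at huv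
      | .inr u, .inl v, huv => by simp [ha, hb] at huv
  · obtain rfl : a = b := funext hm
    exact fun
      | .inl u, .inl v, huv => congrArg _ (hinj hG hGc (Sum.inl_injective (by rwa [ha, ha] at huv)))
      | .inr u, .inr v, huv => congrArg _ (hinj hG hGc (Sum.inr_injective (by rwa [hb, hb] at huv)))
      | .inl u, .inr v, huv => by simp [ha, hb] at huv
      | .inr u, .inl v, huv => by simp [ha, hb] at huv
  · exact (h.not_adj_homs σ ⟨a, @hG⟩ ⟨b, @hGc⟩ hm).elim

/-- The complementary prism of the pentagon, that is the Petersen graph, is a core. -/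
theorem IsSRGWith.isCore_complementaryPrism_of_pentagon (h : G.IsSRGWith 5 2 0 1) :
    G.complementaryPrism.IsCore := by
  have hc : Gᶜ.IsSRGWith 5 2 0 1 := IsSRGWith.compl_conference (l := 0) h
  have tri : ∀ {H : SimpleGraph V} [DecidableRel H.Adj], H.IsSRGWith 5 2 0 1 →
      ∀ {a b c}, H.Adj a b → H.Adj b c → ¬ H.Adj c a := by
    intro H _ hH a b c hab hbc hca
    have := hH.card_inter_of_adj hab
    rw [Finset.card_eq_zero] at this
    have hmem : c ∈ H.neighborFinset a ∩ H.neighborFinset b := by simp [hca.symm, hbc]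
    simp [this] at hmem
  have walk : ∀ {H : SimpleGraph V} [DecidableRel H.Adj], H.IsSRGWith 5 2 0 1 →
      ∀ {a b}, a ≠ b → ¬ H.Adj a b → ∃ x y, H.Adj a x ∧ H.Adj x y ∧ H.Adj y b := by
    intro H _ hH a b hne hab
    have h1 := Finset.card_sdiff_add_card_inter (H.neighborFinset a) (H.neighborFinset b)
    rw [hH.card_inter_of_not_adj hne hab, card_neighborFinset_eq_degree,
      hH.regular.degree_eq] at h1
    -- Only one of the two neighbours of `a` is adjacent to `b`; the other starts the 3-walk.
    obtain ⟨x, hx⟩ := Finset.card_pos.mp (by omega : 0 <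
      (H.neighborFinset a \ H.neighborFinset b).card)
    simp only [Finset.mem_sdiff, mem_neighborFinset] at hx
    obtain ⟨y, hy, hy'⟩ := hH.exists_common_of_not_adj (u := x) (v := b)
      (by rintro rfl; exact hab hx.1) (fun e ↦ hx.2 e.symm)
    exact ⟨x, y, hx.1, hy, hy'.symm⟩
  refine isCore_of_injective (Hom.injective_of_walk_three ?_ ?_)
  · intro a b c hab hbc hca
    have h1 := isLeft_eq_of_triangle hab hbc hca
    have h2 := isLeft_eq_of_triangle hbc hca hab
    rcases a with a | a <;> rcases b with b | b <;> rcases c with c | c <;>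
      simp only [Sum.isLeft_inl, Sum.isLeft_inr, reduceCtorEq] at h1 h2
    · exact tri h hab hbc hca
    · exact tri hc hab hbc hca
  · have cross : ∀ {a b : V}, a ≠ b →
        ∃ x y, G.complementaryPrism.Adj (.inl a) x ∧ G.complementaryPrism.Adj x y ∧
          G.complementaryPrism.Adj y (.inr b) := by
      intro a b hne
      by_cases hab : G.Adj a b
      · obtain ⟨x, hx, hx'⟩ := hc.exists_common_of_not_adj hne fun e ↦ ((compl_adj _ _ _).mp e).2 hab
        exact ⟨.inr a, .inr x, rfl, hx, hx'.symm⟩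
      · obtain ⟨x, hx, hx'⟩ := h.exists_common_of_not_adj hne hab
        exact ⟨.inl x, .inl b, hx, hx'.symm, rfl⟩
    rintro (a | a) (b | b) hne hab
    · obtain ⟨x, y, h1, h2, h3⟩ := walk h (fun e ↦ hne (congrArg _ e)) hab
      exact ⟨.inl x, .inl y, h1, h2, h3⟩
    · exact cross hab
    · obtain ⟨x, y, h1, h2, h3⟩ := cross (Ne.symm hab)
      exact ⟨y, x, h3.symm, h2.symm, h1.symm⟩
    · obtain ⟨x, y, h1, h2, h3⟩ := walk hc (fun e ↦ hne (congrArg _ e)) hab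
      exact ⟨.inr x, .inr y, h1, h2, h3⟩

theorem isCore_complementaryPrism_of_subsingleton [Subsingleton V] :
    G.complementaryPrism.IsCore := by
  refine isCore_of_injective fun f ↦ ?_
  have hm : ∀ v, f (.inl v) ≠ f (.inr v) := fun v ↦
    (f.map_adj (complementaryPrism_adj_inl_inr.mpr rfl)).ne
  rintro (u | u) (v | v) huv <;> obtain rfl := Subsingleton.elim u v
  · rfl
  · exact (hm u huv).elim
  · exact (hm u huv.symm).elim
  · rfl

/-! ### Parameters of self-complementary strongly regular graphs. -/

/-- A self-complementary strongly regular graph with more than one vertex is a conference graph. -/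
theorem IsSRGWith.exists_conference {n k m : ℕ} (h : G.IsSRGWith n k l m) (σ : G ≃g Gᶜ)
    [Nontrivial V] : ∃ t, G.IsSRGWith (4 * t + 5) (2 * t + 2) t (t + 1) := by
  have hc := h.compl
  have hcard : ∀ u v, (Gᶜ.neighborFinset (σ u) ∩ Gᶜ.neighborFinset (σ v)).card =
      (G.neighborFinset u ∩ G.neighborFinset v).card := by
    intro u v
    rw [← Finset.card_map (s := G.neighborFinset u ∩ _) σ.toEquiv.toEmbedding]
    congr 1
    ext x
    obtain ⟨x, rfl⟩ := σ.surjective x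
    have : ∀ u, Gᶜ.Adj (σ u) (σ x) ↔ G.Adj u x := fun u ↦ σ.map_adj_iff
    simp only [Finset.mem_inter, mem_neighborFinset, this, Finset.mem_map]
    constructor
    · rintro hx
      exact ⟨x, hx, rfl⟩
    · rintro ⟨y, hy, e⟩
      rwa [σ.injective e] at hy
  obtain ⟨a, b, hab⟩ := exists_pair_ne V
  have hn : 1 < n := by rw [← h.card]; exact Fintype.one_lt_card
  obtain ⟨u, v, huv⟩ : ∃ u v, G.Adj u v := by
    by_cases ha : G.Adj a b
    · exact ⟨a, b, ha⟩
    · exact ⟨_, _, σ.symm.map_adj_iff.mpr ((compl_adj _ _ _).mpr ⟨hab, ha⟩)⟩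
  have hσ : Gᶜ.Adj (σ u) (σ v) := σ.map_adj_iff.mpr huv
  have hk : k = n - k - 1 := by
    have h1 := hcard u u
    simpa [hc.regular.degree_eq, h.regular.degree_eq, eq_comm] using h1
  have hl : l = n - (2 * k - m) - 2 := by
    have h1 := hcard u v
    rw [hc.card_inter_of_adj hσ, h.card_inter_of_adj huv] at h1
    exact h1.symm
  have hm : m = n - (2 * k - l) := by
    obtain ⟨hne, hna⟩ := (compl_adj _ _ _).mp hσ
    have h1 := hcard (σ u) (σ v)
    rw [hc.card_inter_of_not_adj (σ.injective.ne hne) (fun e ↦ hna (σ.map_adj_iff.mp e)),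
      h.card_inter_of_not_adj hne hna] at h1
    exact h1.symm
  -- This bound and `hmk` control the truncated subtractions in the complement's parameters.
  have hkl : l + 1 ≤ k := by
    rw [← h.regular.degree_eq u, ← card_neighborFinset_eq_degree, ← h.card_inter_of_adj huv]
    refine Finset.card_lt_card ⟨Finset.inter_subset_left, fun hs ↦ ?_⟩
    have := hs ((G.mem_neighborFinset u v).mpr huv)
    simp at this
  have hmk : m ≤ k := by
    obtain ⟨hne, hna⟩ := (compl_adj _ _ _).mp hσ
    rw [← h.card_inter_of_not_adj hne hna, ← h.regular.degree_eq (σ u),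
      ← card_neighborFinset_eq_degree]
    exact Finset.card_le_card Finset.inter_subset_left
  have hpar := IsSRGWith.param_eq G h (by omega)
  -- In `k(k-l-1) = (n-k-1)m` the factor `n-k-1` equals `k`, so `m = k-l-1`.
  rw [← hk] at hpar
  have hpar' := Nat.eq_of_mul_eq_mul_left (by omega) hpar
  refine ⟨l, ?_⟩
  convert h using 1 <;> omega

end

end SimpleGraph

theorem mainTheorem1 {V : Type*} [Fintype V] (Γ : SimpleGraph V) [DecidableRel Γ.Adj]
    (n k l m : ℕ) (hsrg : Γ.IsSRGWith n k l m) (hsc : Γ.IsSelfComplementary) :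
    Γ.complementaryPrism.IsCore := by
  classical
  obtain ⟨σ⟩ := hsc
  cases subsingleton_or_nontrivial V
  · exact SimpleGraph.isCore_complementaryPrism_of_subsingleton
  · obtain ⟨t, ht⟩ := hsrg.exists_conference σ
    rcases eq_or_ne t 0 with rfl | h0
    · exact ht.isCore_complementaryPrism_of_pentagon
    · exact ht.isCore_complementaryPrism_of_ne_zero h0 σ
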